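/- All Banach spaces are complex. A Banach couple $\vec X=(X_0,X_1)$ consists of two Banach spaces continuously embedded in a common Hausdorff topological vector space; an operator $T\colon\vec X\to\vec Y$ is a linear map $X_0+X_1\to Y_0+Y_1$ whose restrictions $X_j\to Y_j$ $(j=0,1)$ are defined and bounded. An interpolation functor $\mathcal F$ assigns to every Banach couple $\vec X$ a Banach space $\mathcal F(\vec X)$ with $X_0\cap X_1\subset\mathcal F(\vec X)\subset X_0+X_1$ (continuously) such that every operator $T\colon\vec X\to\vec Y$ restricts to a bounded operator $\mathcal F(\vec X)\to\mathcal F(\vec Y)$. It is exact if always $\|T\colon\mathcal F(\vec X)\to\mathcal F(\vec Y)\|\le\max\{\|T\colon X_0\to Y_0\|,\|T\colon X_1\to Y_1\|\}$. Its fundamental function is $$\psi_{\mathcal F}(s,t)=\sup\{\|T\colon\mathcal F(\vec X)\to\mathcal F(\vec Y)\| : \|T\colon X_0\to Y_0\|\le s,\ \|T\colon X_1\to Y_1\|\le t\},\qquad s,t>0,$$ the supremum being over all Banach couples $\vec X,\vec Y$ and operators $T\colon\vec X\to\vec Y$. For $m,n\in\mathbb N=\{1,2,\dots\}$ let $\Lambda^{\le}(m,n)$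 be the set of all $\alpha\in\mathbb N_0^n$ with $\alpha_1+\dots+\alpha_n\le m$, and let $\mathcal P_{\le m}(\mathbb T^n)$ be the space of polynomials $f(z)=\sum_{\alpha\in\Lambda^{\le}(m,n)}c_\alpha z^\alpha$ on the torus $\mathbb T^n$ with the supremum norm. For $\xi=(\xi_\alpha)\in\mathbb C^{\Lambda^{\le}(m,n)}$ let $M_\xi\colon\mathcal P_{\le m}(\mathbb T^n)\to\ell_1(\Lambda^{\le}(m,n))$, $M_\xi f=(\xi_\alpha\hat f(\alpha))_\alpha$, where $\hat f(\alpha)$ is the Fourier coefficient. **Theorem.** Let $\mathcal F$ be an exact interpolation functor, normalized by $\|1\|_{\mathcal F(\mathbb C,\mathbb C)}\le1$. Let $m,n\in\mathbb N$ and $$X=\mathcal F\big(\ell_1(\Lambda^{\le}(m,n)),\,\ell_{2m/(m+1)}(\Lambda^{\le}(m,n))\big).$$ Then for every $\xi\in\mathbb C^{\Lambda^{\le}(m,n)}$ $$\sup_{\|\mu\|_{\ell_2(\Lambda^{\le}(m,n))}\le1}\|(\xi_\alpha\mu_\alpha)_{\alpha}\|_X\le C(m)\,\sqrt n\,\big\|M_\xi\colon\mathcal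 P_{\le m}(\mathbb T^n)\to\ell_1(\Lambda^{\le}(m,n))\big\|,$$ where $C(m)=2\sqrt2\,e^2\,\psi_{\mathcal F}(1,1)\,\psi_{\mathcal F}\big(\sqrt{\log(1+20m)},1\big)$. -/

import Mathlib

open scoped ENNReal
open MeasureTheory

noncomputable section

namespace KislyakovInterpolation

/-! ### Banach couples and interpolation functors -/

/-- A complex Banach space continuously (and linearly) embedded in the topological vector space
`V`; the vectors of `V` that belong to the space are those in the range of `ι`. -/
structure BanachIn (V : Type) [AddCommGroup V] [Module ℂ V] [TopologicalSpace V] where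
  E : Type
  [normedAddCommGroup : NormedAddCommGroup E]
  [normedSpace : NormedSpace ℂ E]
  [completeSpace : CompleteSpace E]
  ι : E →L[ℂ] V
  injective : Function.Injective ι

attribute [instance] BanachIn.normedAddCommGroup BanachIn.normedSpace BanachIn.completeSpace

section

variable {V : Type} [AddCommGroup V] [Module ℂ V] [TopologicalSpace V]

/-- The linear subspace of `V` underlying an embedded Banach space. -/
def BanachIn.subspace (Z : BanachIn V) : Submodule ℂ V := LinearMap.range Z.ι.toLinearMap

/-- The norm `‖v‖_Z` of `v : V` in the embedded Banach space `Z`, with value `∞` if `v` does not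
belong to `Z`. (There is at most one `x` with `Z.ι x = v`.) -/
def BanachIn.nrm (Z : BanachIn V) (v : V) : ℝ≥0∞ := ⨅ (x : Z.E) (_ : Z.ι x = v), ‖x‖ₑ

end

/-- A Banach couple: two complex Banach spaces continuously embedded in a common Hausdorff
topological vector space `V`. -/
structure BanachCouple where
  V : Type
  [addCommGroup : AddCommGroup V]
  [module : Module ℂ V]
  [topologicalSpace : TopologicalSpace V]
  [isTopologicalAddGroup : IsTopologicalAddGroup V]
  [continuousSMul : ContinuousSMul ℂ V]
  [t2Space : T2Space V]
  X₀ : BanachIn V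
  X₁ : BanachIn V

attribute [instance] BanachCouple.addCommGroup BanachCouple.module BanachCouple.topologicalSpace
  BanachCouple.isTopologicalAddGroup BanachCouple.continuousSMul BanachCouple.t2Space

/-- `X₀ + X₁`. -/
def BanachCouple.sum (X : BanachCouple) : Submodule ℂ X.V := X.X₀.subspace ⊔ X.X₁.subspace

/-- `X₀ ∩ X₁`. -/
def BanachCouple.inter (X : BanachCouple) : Submodule ℂ X.V := X.X₀.subspace ⊓ X.X₁.subspace

/-- An operator `T : (X₀, X₁) → (Y₀, Y₁)` between Banach couples: a linear map
`X₀ + X₁ → Y₀ + Y₁` whose restrictions are bounded operators `T₀ : X₀ → Y₀`, `T₁ : X₁ → Y₁`. -/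
structure CoupleHom (X Y : BanachCouple) where
  T : X.sum →ₗ[ℂ] Y.sum
  T₀ : X.X₀.E →L[ℂ] Y.X₀.E
  T₁ : X.X₁.E →L[ℂ] Y.X₁.E
  restrict₀ : ∀ (x : X.X₀.E) (v : X.sum), (v : X.V) = X.X₀.ι x → (T v : Y.V) = Y.X₀.ι (T₀ x)
  restrict₁ : ∀ (x : X.X₁.E) (v : X.sum), (v : X.V) = X.X₁.ι x → (T v : Y.V) = Y.X₁.ι (T₁ x)

/-- The norm `max {‖T : X₀ → Y₀‖, ‖T : X₁ → Y₁‖}` of an operator between Banach couples. -/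
def CoupleHom.norm {X Y : BanachCouple} (T : CoupleHom X Y) : ℝ := max ‖T.T₀‖ ‖T.T₁‖

/-- An interpolation functor: it assigns to every Banach couple an intermediate Banach space, and
every operator `T` between couples restricts to a bounded operator `map T` between the assigned
spaces (which is uniquely determined by `map_spec`). -/
structure InterpolationFunctor where
  obj : (X : BanachCouple) → BanachIn X.V
  inter_le : ∀ X : BanachCouple, X.inter ≤ (obj X).subspace
  le_sum : ∀ X : BanachCouple, (obj X).subspace ≤ X.sum
  map : {X Y : BanachCouple} → CoupleHom X Y → (obj X).E →L[ℂ] (obj Y).E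
  map_spec : ∀ {X Y : BanachCouple} (T : CoupleHom X Y) (x : (obj X).E) (v : X.sum),
    (v : X.V) = (obj X).ι x → (T.T v : Y.V) = (obj Y).ι (map T x)

/-- Exactness: `‖T : 𝓕(X) → 𝓕(Y)‖ ≤ max {‖T : X₀ → Y₀‖, ‖T : X₁ → Y₁‖}`. -/
def InterpolationFunctor.IsExact (F : InterpolationFunctor) : Prop :=
  ∀ (X Y : BanachCouple) (T : CoupleHom X Y), ‖F.map T‖ ≤ T.norm

/-- The fundamental function `ψ_𝓕(s, t)`: the supremum of `‖T : 𝓕(X) → 𝓕(Y)‖` over all operators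
with `‖T : X₀ → Y₀‖ ≤ s` and `‖T : X₁ → Y₁‖ ≤ t` (bounded by `max s t` if `𝓕` is exact). -/
def InterpolationFunctor.fundamentalFunction (F : InterpolationFunctor) (s t : ℝ) : ℝ :=
  sSup {r : ℝ | ∃ (X Y : BanachCouple) (T : CoupleHom X Y), ‖T.T₀‖ ≤ s ∧ ‖T.T₁‖ ≤ t ∧
    r = ‖F.map T‖}

/-- The scalar field `ℂ` as a Banach space in itself. -/
def scalarBanach : BanachIn ℂ where
  E := ℂ
  ι := ContinuousLinearMap.id ℂ ℂ
  injective := Function.injective_id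

/-- The couple `(ℂ, ℂ)`. -/
def scalarCouple : BanachCouple where
  V := ℂ
  X₀ := scalarBanach
  X₁ := scalarBanach

/-- The normalization `‖1‖_{𝓕(ℂ, ℂ)} ≤ 1`. -/
def InterpolationFunctor.IsNormalized (F : InterpolationFunctor) : Prop :=
  (F.obj scalarCouple).nrm (1 : ℂ) ≤ 1

/-! ### The spaces `ℓ_p(Λ)` -/

/-- `ℓ_p(Λ)` as a Banach space inside `ℂ^Λ`. -/
def ellp (Λ : Type) [Fintype Λ] (p : ℝ≥0∞) [Fact (1 ≤ p)] : BanachIn (Λ → ℂ) where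
  E := PiLp p (fun _ : Λ => ℂ)
  ι := (PiLp.continuousLinearEquiv p ℂ (fun _ : Λ => ℂ)).toContinuousLinearMap
  injective := (PiLp.continuousLinearEquiv p ℂ (fun _ : Λ => ℂ)).injective

/-- The multi-indices `α = (α₁, …, αₙ)` of nonnegative integers with `∑ αⱼ ≤ m`. -/
abbrev MultiIndex (m n : ℕ) : Type := {α : Fin n → ℕ // ∑ j, α j ≤ m}

instance (m n : ℕ) : Finite (MultiIndex m n) := by
  refine Set.Finite.subset (Set.finite_Iic (fun _ : Fin n => m)) ?_
  intro α hα j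
  exact (Finset.single_le_sum (f := α) (fun _ _ => Nat.zero_le _) (Finset.mem_univ j)).trans hα

instance (m n : ℕ) : Fintype (MultiIndex m n) := Fintype.ofFinite _

/-- The exponent `2m/(m+1)`. -/
def bhExponent (m : ℕ) : ℝ≥0∞ := ENNReal.ofReal (2 * m / (m + 1))

theorem one_le_bhExponent {m : ℕ} (hm : 1 ≤ m) : 1 ≤ bhExponent m := by
  have h : (1 : ℝ) ≤ m := by exact_mod_cast hm
  rw [bhExponent, ENNReal.one_le_ofReal, le_div_iff₀ (by positivity)]
  linarith

/-- The couple `(ℓ_1, ℓ_{2m/(m+1)})` over the multi-indices of order at most `m` and length `n`. -/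
def ellCouple (m n : ℕ) (hm : 1 ≤ m) : BanachCouple where
  V := MultiIndex m n → ℂ
  X₀ := ellp (MultiIndex m n) 1
  X₁ :=
    haveI : Fact (1 ≤ bhExponent m) := ⟨one_le_bhExponent hm⟩
    ellp (MultiIndex m n) (bhExponent m)

/-! ### Analytic polynomials on the torus and multipliers

The torus `𝕋ⁿ` is `UnitAddTorus (Fin n) = (ℝ/ℤ)ⁿ`, where `zⱼ = exp (2πi xⱼ)`: the monomial `z^α` is
`UnitAddTorus.mFourier α`, and Fourier coefficients are taken with respect to Haar measure. -/

/-- A multi-index as a vector of integers, that is, as a character of the torus. -/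
def MultiIndex.toInt {m n : ℕ} (α : MultiIndex m n) : Fin n → ℤ := fun j => (α.1 j : ℤ)

/-- `𝓟_{≤ m}(𝕋ⁿ)`: the analytic polynomials of degree at most `m`, as a subspace of `C(𝕋ⁿ)` with the
supremum norm. -/
def polySpace (m n : ℕ) : Submodule ℂ C(UnitAddTorus (Fin n), ℂ) :=
  Submodule.span ℂ (Set.range fun α : MultiIndex m n => UnitAddTorus.mFourier α.toInt)

/-- `𝓟_{≤ m}(𝕋ⁿ)` as a normed space. -/
def PolySpace (m n : ℕ) : Type := polySpace m n

instance (m n : ℕ) : NormedAddCommGroup (PolySpace m n) :=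
  inferInstanceAs (NormedAddCommGroup (polySpace m n))

instance (m n : ℕ) : NormedSpace ℂ (PolySpace m n) :=
  inferInstanceAs (NormedSpace ℂ (polySpace m n))

instance (m n : ℕ) : FiniteDimensional ℂ (PolySpace m n) :=
  FiniteDimensional.span_of_finite ℂ (Set.finite_range _)

/-- A polynomial as a continuous function on the torus. -/
def PolySpace.toContinuousMap {m n : ℕ} (f : PolySpace m n) : C(UnitAddTorus (Fin n), ℂ) := f.1

theorem PolySpace.norm_eq {m n : ℕ} (f : PolySpace m n) : ‖f‖ = ‖f.toContinuousMap‖ := rfl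

theorem integrable_mFourier_smul {n : ℕ} (k : Fin n → ℤ) (f : C(UnitAddTorus (Fin n), ℂ)) :
    Integrable (fun t => UnitAddTorus.mFourier (-k) t • f t)
      (Measure.pi fun _ : Fin n => (AddCircle.haarAddCircle : Measure UnitAddCircle)) := by
  refine Continuous.integrable_of_hasCompactSupport ?_ (HasCompactSupport.of_compactSpace _)
  fun_prop

theorem mFourierCoeff_add {n : ℕ} (k : Fin n → ℤ) (f g : C(UnitAddTorus (Fin n), ℂ)) :
    UnitAddTorus.mFourierCoeff (fun t => (f + g) t) k
      = UnitAddTorus.mFourierCoeff f k + UnitAddTorus.mFourierCoeff g k := by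
  refine Eq.trans ?_ (integral_add (integrable_mFourier_smul k f) (integrable_mFourier_smul k g))
  simp only [UnitAddTorus.mFourierCoeff, ContinuousMap.add_apply, smul_add]

theorem mFourierCoeff_smul {n : ℕ} (k : Fin n → ℤ) (c : ℂ) (f : C(UnitAddTorus (Fin n), ℂ)) :
    UnitAddTorus.mFourierCoeff (fun t => (c • f) t) k = c * UnitAddTorus.mFourierCoeff f k := by
  unfold UnitAddTorus.mFourierCoeff
  rw [← integral_const_mul]
  simp only [ContinuousMap.smul_apply, smul_eq_mul, mul_left_comm]

/-- The multiplier `M_ξ : 𝓟_{≤ m}(𝕋ⁿ) → ℓ_1`, `f ↦ (ξ_α f^(α))_α`. -/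
def multiplier {m n : ℕ} (ξ : MultiIndex m n → ℂ) :
    PolySpace m n →L[ℂ] PiLp 1 (fun _ : MultiIndex m n => ℂ) :=
  LinearMap.toContinuousLinearMap
    { toFun := fun f => WithLp.toLp 1 fun α =>
        ξ α * UnitAddTorus.mFourierCoeff f.toContinuousMap α.toInt
      map_add' := by
        intro f g
        ext α
        change ξ α * _ = ξ α * _ + ξ α * _
        rw [← mul_add, ← mFourierCoeff_add]
        rfl
      map_smul' := by
        intro c f
        ext α
        change ξ α * _ = c * (ξ α * _)
        rw [mul_left_comm c, ← mFourierCoeff_smul _ c]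
        rfl }

end KislyakovInterpolation

end

/-! Choose signs `ε` such that `f = ∑ α, ε α * μ α * z ^ α` satisfies the Kahane–Salem–Zygmund bound
`‖f‖_∞ ≤ 2√2 e² √(n log (1 + 20 m)) ‖μ‖₂`. They exist because Khintchine's inequality bounds the
average of `∫ |f| ^ (2 k)` over all signs, and for `k = n ⌈log (1 + 20 m)⌉` Nikolskii's inequality
passes from `L_{2k}` to the supremum norm at the cost of a constant. Since `M_ξ` does not see the
signs, `‖ξ μ‖_{ℓ_1} ≤ ‖M_ξ‖ ‖f‖_∞`. In the other endpoint `ℓ_{2m/(m+1)}`, Hölder's inequality and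
`|ξ α| ≤ ‖M_ξ‖` suffice, because `|Λ^≤(m, n)|^{1/m} ≤ 2 e n`. The two estimates bound the operator
`c ↦ c • ξ μ` from `(ℂ, ℂ)` into `(ℓ_1, ℓ_{2m/(m+1)})`, and applying `𝓕` to it gives the norm of
`ξ μ` in `X`. -/

noncomputable section

namespace KislyakovInterpolation

section RandomSigns

open Real
open scoped BigOperators

theorem pow_two_mul_le_factorial_mul_cosh (x : ℝ) (k : ℕ) :
    x ^ (2 * k) ≤ (2 * k).factorial * cosh x := by
  have hterm := le_hasSum (hasSum_cosh x) k fun j _ => by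
    rw [pow_mul]; positivity
  rwa [div_le_iff₀' (by positivity)] at hterm

variable {Λ : Type*} [Fintype Λ] [DecidableEq Λ]

theorem expect_exp_sum_sign_smul (a : Λ → ℝ) :
    𝔼 ε : Λ → ℤˣ, exp (∑ i, ε i • a i) = ∏ i, cosh (a i) := by
  have hcosh (i : Λ) : ∑ s : ℤˣ, exp (s • a i) = 2 * cosh (a i) := by
    simp [Units.smul_def, cosh_eq, mul_div_cancel₀]
  have hprod : ∑ ε : Λ → ℤˣ, ∏ i, exp (ε i • a i) = ∏ i, (2 * cosh (a i)) := by
    simp only [← hcosh, Finset.prod_univ_sum, Fintype.piFinset_univ]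
  rw [Fintype.expect_eq_sum_div_card]
  simp only [exp_sum]
  rw [hprod, Finset.prod_mul_distrib]
  simp

theorem expect_cosh_sum_sign_smul (a : Λ → ℝ) :
    𝔼 ε : Λ → ℤˣ, cosh (∑ i, ε i • a i) = ∏ i, cosh (a i) := by
  have hneg : 𝔼 ε : Λ → ℤˣ, exp (-∑ i, ε i • a i) = ∏ i, cosh (a i) := by
    simpa only [smul_neg, Finset.sum_neg_distrib, cosh_neg] using expect_exp_sum_sign_smul (-a ·)
  have hcosh (x : ℝ) : cosh x = (exp x + exp (-x)) / 2 := cosh_eq x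
  simp only [hcosh (∑ _, _), ← Finset.expect_div, Finset.expect_add_distrib,
    expect_exp_sum_sign_smul, hneg, add_self_div_two]

theorem expect_sum_sign_smul_pow_le_factorial_mul_exp (a : Λ → ℝ) (k : ℕ) :
    𝔼 ε : Λ → ℤˣ, (∑ i, ε i • a i) ^ (2 * k) ≤
      (2 * k).factorial * exp ((∑ i, a i ^ 2) / 2) :=
  calc 𝔼 ε : Λ → ℤˣ, (∑ i, ε i • a i) ^ (2 * k)
      ≤ 𝔼 ε : Λ → ℤˣ, (2 * k).factorial * cosh (∑ i, ε i • a i) :=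
        Finset.expect_le_expect fun _ _ => pow_two_mul_le_factorial_mul_cosh _ k
    _ = (2 * k).factorial * ∏ i, cosh (a i) := by
        rw [← Finset.mul_expect, expect_cosh_sum_sign_smul]
    _ ≤ (2 * k).factorial * ∏ i, exp (a i ^ 2 / 2) := by
        gcongr with i
        exact cosh_le_exp_half_sq (a i)
    _ = (2 * k).factorial * exp ((∑ i, a i ^ 2) / 2) := by rw [← exp_sum, Finset.sum_div]

theorem expect_sum_sign_smul_pow_le (a : Λ → ℝ) (k : ℕ) :
    𝔼 ε : Λ → ℤˣ, (∑ i, ε i • a i) ^ (2 * k) ≤ (2 * exp 1 * k * ∑ i, a i ^ 2) ^ k := by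
  rcases k.eq_zero_or_pos with rfl | hk
  · simp
  rcases (Finset.sum_nonneg fun i _ => sq_nonneg (a i)).eq_or_lt' with hzero | hpos
  · have ha (i : Λ) : a i = 0 := by
      simpa using (Finset.sum_eq_zero_iff_of_nonneg fun i _ => sq_nonneg (a i)).1 hzero i
        (Finset.mem_univ i)
    simp [ha, hk.ne']
  set V := ∑ i, a i ^ 2
  -- Rescaling to variance `2 k` balances the factorial against the exponential.
  obtain ⟨t, ht, htV⟩ : ∃ t > 0, t ^ 2 * V = 2 * k :=
    ⟨√(2 * k / V), by positivity, by rw [sq_sqrt (by positivity), div_mul_cancel₀ _ hpos.ne']⟩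
  have hscale (ε : Λ → ℤˣ) : ∑ i, ε i • (t * a i) = t * ∑ i, ε i • a i := by
    simp only [Units.smul_def, zsmul_eq_mul, Finset.mul_sum, mul_left_comm]
  have hmoment := expect_sum_sign_smul_pow_le_factorial_mul_exp (fun i => t * a i) k
  simp only [hscale, mul_pow, ← Finset.mul_sum, ← Finset.mul_expect] at hmoment
  rw [htV, mul_div_cancel_left₀ _ two_ne_zero] at hmoment
  refine le_of_mul_le_mul_left ?_ (pow_pos ht (2 * k))
  calc t ^ (2 * k) * 𝔼 ε : Λ → ℤˣ, (∑ i, ε i • a i) ^ (2 * k)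
      ≤ (2 * k).factorial * exp k := hmoment
    _ ≤ (2 * k) ^ (2 * k) * exp k := by
        gcongr
        exact_mod_cast Nat.factorial_le_pow (2 * k)
    _ = ((2 * k) ^ 2 * exp 1) ^ k := by rw [mul_pow _ (exp 1), ← pow_mul, ← exp_nat_mul, mul_one]
    _ = (t ^ 2 * (2 * exp 1 * k * V)) ^ k := by
        congr 1
        linear_combination (-2 * exp 1 * k) * htV
    _ = t ^ (2 * k) * (2 * exp 1 * k * V) ^ k := by rw [mul_pow, ← pow_mul]

theorem expect_norm_sum_sign_smul_pow_le (a : Λ → ℂ) (k : ℕ) :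
    𝔼 ε : Λ → ℤˣ, ‖∑ i, ε i • a i‖ ^ (2 * k) ≤ (4 * exp 1 * k * ∑ i, ‖a i‖ ^ 2) ^ k := by
  rcases k.eq_zero_or_pos with rfl | hk
  · simp
  have hsq (z : ℂ) : ‖z‖ ^ 2 = z.re ^ 2 + z.im ^ 2 := by
    rw [Complex.sq_norm, Complex.normSq_apply, sq, sq]
  have hsplit (ε : Λ → ℤˣ) : ‖∑ i, ε i • a i‖ ^ (2 * k) ≤ 2 ^ (k - 1) *
      ((∑ i, ε i • (a i).re) ^ (2 * k) + (∑ i, ε i • (a i).im) ^ (2 * k)) := by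
    have hre : (∑ i, ε i • a i).re = ∑ i, ε i • (a i).re := by
      simp [Units.smul_def, Complex.re_sum]
    have him : (∑ i, ε i • a i).im = ∑ i, ε i • (a i).im := by
      simp [Units.smul_def, Complex.im_sum]
    rw [pow_mul, hsq, hre, him, pow_mul, pow_mul]
    exact add_pow_le (sq_nonneg _) (sq_nonneg _) k
  calc 𝔼 ε : Λ → ℤˣ, ‖∑ i, ε i • a i‖ ^ (2 * k)
      ≤ 2 ^ (k - 1) * (𝔼 ε : Λ → ℤˣ, (∑ i, ε i • (a i).re) ^ (2 * k) +
          𝔼 ε : Λ → ℤˣ, (∑ i, ε i • (a i).im) ^ (2 * k)) := by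
        rw [← Finset.expect_add_distrib, Finset.mul_expect]
        exact Finset.expect_le_expect fun ε _ => hsplit ε
    _ ≤ 2 ^ (k - 1) * ((2 * exp 1 * k * ∑ i, ‖a i‖ ^ 2) ^ k +
          (2 * exp 1 * k * ∑ i, ‖a i‖ ^ 2) ^ k) := by
        gcongr
        · refine (expect_sum_sign_smul_pow_le _ k).trans ?_
          gcongr ((2 * exp 1 * k * ∑ i, ?_) ^ k) with i
          exact hsq (a i) ▸ le_add_of_nonneg_right (sq_nonneg _)
        · refine (expect_sum_sign_smul_pow_le _ k).trans ?_
          gcongr ((2 * exp 1 * k * ∑ i, ?_) ^ k) with i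
          exact hsq (a i) ▸ le_add_of_nonneg_left (sq_nonneg _)
    _ = (4 * exp 1 * k * ∑ i, ‖a i‖ ^ 2) ^ k := by
        rw [← two_mul, ← mul_assoc, pow_sub_one_mul hk.ne', ← mul_pow]
        ring

end RandomSigns

section Counting

/-- Appending the slack `m - ∑ j, α j` as an extra coordinate turns the multi-indices of order at
most `m` into those of order exactly `m`. -/
def multiIndexEquiv (m n : ℕ) : MultiIndex m n ≃ {P : Fin (n + 1) → ℕ // ∑ j, P j = m} where
  toFun α := ⟨Fin.cons (m - ∑ j, α.1 j) α.1, by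
    rw [Fin.sum_cons, Nat.sub_add_cancel α.2]⟩
  invFun P := ⟨Fin.tail P.1,
    (Nat.le_add_left _ _).trans_eq ((Fin.sum_univ_succ P.1).symm.trans P.2)⟩
  left_inv _ := rfl
  right_inv P := by
    have hhead : m - ∑ j, Fin.tail P.1 j = P.1 0 :=
      Nat.sub_eq_of_eq_add ((Fin.sum_univ_succ P.1).symm.trans P.2).symm
    exact Subtype.ext (by simp only [hhead, Fin.cons_self_tail])

theorem card_multiIndex (m n : ℕ) : Fintype.card (MultiIndex m n) = (n + m).choose m := by
  rw [Fintype.card_congr ((multiIndexEquiv m n).trans (Sym.equivNatSumOfFintype _ m).symm),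
    Sym.card_sym_eq_choose, Fintype.card_fin, Nat.add_right_comm, Nat.add_sub_cancel]

theorem choose_add_le_pow (a : ℕ) {b : ℕ} (hb : 0 < b) :
    ((a + b).choose b : ℝ) ≤ (Real.exp 1 * (1 + a / b)) ^ b := by
  have hb' : (0 : ℝ) < b := Nat.cast_pos.2 hb
  calc ((a + b).choose b : ℝ) ≤ (a + b : ℕ) ^ b / b.factorial := Nat.choose_le_pow_div b (a + b)
    _ = (b : ℝ) ^ b / b.factorial * (1 + a / b) ^ b := by
        rw [div_mul_eq_mul_div, ← mul_pow, mul_one_add, mul_div_cancel₀ _ hb'.ne', Nat.cast_add,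
          add_comm]
    _ ≤ Real.exp b * (1 + a / b) ^ b := by
        gcongr
        exact Real.pow_div_factorial_le_exp b hb'.le b
    _ = (Real.exp 1 * (1 + a / b)) ^ b := by rw [mul_pow, ← Real.exp_nat_mul, mul_one]

theorem card_multiIndex_le_pow_degree {m : ℕ} (hm : 0 < m) (n : ℕ) :
    (Fintype.card (MultiIndex m n) : ℝ) ≤ (Real.exp 1 * (1 + n / m)) ^ m := by
  rw [card_multiIndex]
  exact choose_add_le_pow n hm

theorem card_multiIndex_le_pow_length (m : ℕ) {n : ℕ} (hn : 0 < n) :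
    (Fintype.card (MultiIndex m n) : ℝ) ≤ (Real.exp 1 * (1 + m / n)) ^ n := by
  rw [card_multiIndex, ← Nat.choose_symm_add, add_comm]
  exact choose_add_le_pow m hn

end Counting

section Polynomials

open UnitAddTorus

variable {m n : ℕ}

/-- The normalized Haar measure on the torus `𝕋ⁿ`. -/
abbrev torusHaar (n : ℕ) : Measure (UnitAddTorus (Fin n)) :=
  Measure.pi fun _ : Fin n => AddCircle.haarAddCircle

/-- The analytic polynomial `∑ α, c α • z ^ α` with coefficients `c`, as a continuous function on
the torus. -/
def analyticPoly (c : MultiIndex m n → ℂ) : C(UnitAddTorus (Fin n), ℂ) :=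
  ∑ α, c α • mFourier α.toInt

theorem analyticPoly_apply (c : MultiIndex m n → ℂ) (x : UnitAddTorus (Fin n)) :
    analyticPoly c x = ∑ α, c α * mFourier α.toInt x := by
  simp only [analyticPoly, ContinuousMap.sum_apply, ContinuousMap.smul_apply, smul_eq_mul]

theorem mem_polySpace_iff {f : C(UnitAddTorus (Fin n), ℂ)} :
    f ∈ polySpace m n ↔ ∃ c : MultiIndex m n → ℂ, analyticPoly c = f :=
  Submodule.mem_span_range_iff_exists_fun ℂ

theorem norm_mFourier_apply (k : Fin n → ℤ) (x : UnitAddTorus (Fin n)) : ‖mFourier k x‖ = 1 := by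
  simp only [mFourier, ContinuousMap.coe_mk, norm_prod, fourier_apply, Circle.norm_coe,
    Finset.prod_const_one]

theorem MultiIndex.toInt_injective :
    Function.Injective (MultiIndex.toInt : MultiIndex m n → Fin n → ℤ) := fun _ _ h =>
  Subtype.ext (funext fun j => Nat.cast_injective (congrFun h j))

theorem orthonormal_mFourierLp_toInt :
    Orthonormal ℂ fun α : MultiIndex m n => mFourierLp (d := Fin n) 2 α.toInt :=
  orthonormal_mFourier.comp _ MultiIndex.toInt_injective

theorem toLp_analyticPoly (c : MultiIndex m n → ℂ) :
    (analyticPoly c).toLp 2 (torusHaar n) ℂ = ∑ α, c α • mFourierLp 2 α.toInt := by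
  simp only [analyticPoly, map_sum, map_smul]
  rfl

theorem mFourierCoeff_analyticPoly (c : MultiIndex m n → ℂ) (α : MultiIndex m n) :
    mFourierCoeff (analyticPoly c) α.toInt = c α := by
  rw [← orthonormal_mFourierLp_toInt.inner_right_fintype c α, ← toLp_analyticPoly]
  refine Eq.trans ?_ (ContinuousMap.inner_toLp (torusHaar n) _ _).symm
  simp only [mFourierCoeff, mFourier_neg, smul_eq_mul, mul_comm]
  rfl

theorem integral_norm_sq_analyticPoly (c : MultiIndex m n → ℂ) :
    ∫ x, ‖analyticPoly c x‖ ^ 2 ∂torusHaar n = ∑ α, ‖c α‖ ^ 2 := by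
  have h := orthonormal_mFourierLp_toInt.inner_sum c c Finset.univ
  rw [← toLp_analyticPoly, ContinuousMap.inner_toLp] at h
  simp only [RCLike.mul_conj, RCLike.conj_mul] at h
  exact_mod_cast h

theorem norm_apply_sq_le_card_mul_integral {f : C(UnitAddTorus (Fin n), ℂ)}
    (hf : f ∈ polySpace m n) (x : UnitAddTorus (Fin n)) :
    ‖f x‖ ^ 2 ≤ Fintype.card (MultiIndex m n) * ∫ y, ‖f y‖ ^ 2 ∂torusHaar n := by
  obtain ⟨c, rfl⟩ := mem_polySpace_iff.1 hf
  rw [integral_norm_sq_analyticPoly]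
  calc ‖analyticPoly c x‖ ^ 2 ≤ (∑ α, ‖c α‖) ^ 2 := by
        gcongr
        rw [analyticPoly_apply]
        exact (norm_sum_le _ _).trans_eq
          (by simp only [norm_mul, norm_mFourier_apply, mul_one])
    _ ≤ Fintype.card (MultiIndex m n) * ∑ α, ‖c α‖ ^ 2 := sq_sum_le_card_mul_sum_sq

theorem one_mem_polySpace : (1 : C(UnitAddTorus (Fin n), ℂ)) ∈ polySpace m n := by
  refine Submodule.subset_span ⟨⟨0, by simp⟩, ?_⟩
  exact mFourier_zero

theorem mul_mem_polySpace {a b : ℕ} {f g : C(UnitAddTorus (Fin n), ℂ)}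
    (hf : f ∈ polySpace a n) (hg : g ∈ polySpace b n) : f * g ∈ polySpace (a + b) n := by
  have hfg := Submodule.mul_mem_mul hf hg
  rw [polySpace, polySpace, Submodule.span_mul_span] at hfg
  refine Submodule.span_mono ?_ hfg
  rintro _ ⟨_, ⟨α, rfl⟩, _, ⟨β, rfl⟩, rfl⟩
  have hdeg : ∑ j, (α.1 + β.1) j ≤ a + b := by
    simpa only [Pi.add_apply, Finset.sum_add_distrib] using add_le_add α.2 β.2
  have htoInt : MultiIndex.toInt ⟨α.1 + β.1, hdeg⟩ = α.toInt + β.toInt :=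
    funext fun j => Nat.cast_add (α.1 j) (β.1 j)
  refine ⟨⟨α.1 + β.1, hdeg⟩, ContinuousMap.ext fun x => ?_⟩
  simp only [htoInt, mFourier_add, ContinuousMap.mul_apply]

theorem pow_mem_polySpace {f : C(UnitAddTorus (Fin n), ℂ)} (hf : f ∈ polySpace m n) (k : ℕ) :
    f ^ k ∈ polySpace (k * m) n := by
  induction k with
  | zero => exact one_mem_polySpace
  | succ k ih =>
    rw [pow_succ, Nat.succ_mul]
    exact mul_mem_polySpace ih hf

/-- Nikolskii's inequality, from applying the case `k = 1` to the polynomial `f ^ k`. -/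
theorem norm_apply_pow_le_card_mul_integral {f : C(UnitAddTorus (Fin n), ℂ)}
    (hf : f ∈ polySpace m n) (k : ℕ) (x : UnitAddTorus (Fin n)) :
    ‖f x‖ ^ (2 * k) ≤
      Fintype.card (MultiIndex (k * m) n) * ∫ y, ‖f y‖ ^ (2 * k) ∂torusHaar n := by
  simpa only [ContinuousMap.pow_apply, norm_pow, ← pow_mul, mul_comm k 2] using
    norm_apply_sq_le_card_mul_integral (pow_mem_polySpace hf k) x

end Polynomials

section KahaneSalemZygmund

open Real UnitAddTorus
open scoped BigOperators

variable {m n : ℕ}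

theorem exists_sign_integral_norm_analyticPoly_pow_le (c : MultiIndex m n → ℂ) (k : ℕ) :
    ∃ ε : MultiIndex m n → ℤˣ, ∫ x, ‖analyticPoly (ε • c) x‖ ^ (2 * k) ∂torusHaar n ≤
      (4 * exp 1 * k * ∑ α, ‖c α‖ ^ 2) ^ k := by
  classical
  have hmoment (x : UnitAddTorus (Fin n)) :
      𝔼 ε : MultiIndex m n → ℤˣ, ‖analyticPoly (ε • c) x‖ ^ (2 * k) ≤
        (4 * exp 1 * k * ∑ α, ‖c α‖ ^ 2) ^ k := by
    simpa only [analyticPoly_apply, Pi.smul_apply', smul_mul_assoc, norm_mul,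
      norm_mFourier_apply, mul_one] using
      expect_norm_sum_sign_smul_pow_le (fun α => c α * mFourier α.toInt x) k
  have hint (f : C(UnitAddTorus (Fin n), ℂ)) :
      Integrable (fun x => ‖f x‖ ^ (2 * k)) (torusHaar n) :=
    Continuous.integrable_of_hasCompactSupport (by fun_prop) (.of_compactSpace _)
  obtain ⟨ε, -, hε⟩ := Finset.exists_le_of_expect_le Finset.univ_nonempty <|
    calc 𝔼 ε : MultiIndex m n → ℤˣ, ∫ x, ‖analyticPoly (ε • c) x‖ ^ (2 * k) ∂torusHaar n
        = ∫ x, 𝔼 ε : MultiIndex m n → ℤˣ, ‖analyticPoly (ε • c) x‖ ^ (2 * k) ∂torusHaar n := by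
          simp only [Fintype.expect_eq_sum_div_card]
          rw [integral_div, integral_finsetSum _ fun ε _ => hint _]
      _ ≤ ∫ _, (4 * exp 1 * k * ∑ α, ‖c α‖ ^ 2) ^ k ∂torusHaar n :=
          integral_mono_of_nonneg
            (.of_forall fun x => Finset.expect_nonneg fun _ _ => by positivity)
            (integrable_const _) (.of_forall hmoment)
      _ = (4 * exp 1 * k * ∑ α, ‖c α‖ ^ 2) ^ k := by simp
  exact ⟨ε, hε⟩

theorem exists_sign_norm_analyticPoly_apply_pow_le (hn : 0 < n) (c : MultiIndex m n → ℂ) (j : ℕ) :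
    ∃ ε : MultiIndex m n → ℤˣ, ∀ x, (‖analyticPoly (ε • c) x‖ ^ 2) ^ j ≤
      exp 1 * (1 + j * m) * (4 * exp 1 * (n * j) * ∑ α, ‖c α‖ ^ 2) ^ j := by
  obtain ⟨ε, hε⟩ := exists_sign_integral_norm_analyticPoly_pow_le c (n * j)
  refine ⟨ε, fun x => ?_⟩
  have hn' : (n : ℝ) ≠ 0 := Nat.cast_ne_zero.2 hn.ne'
  have hcard : (Fintype.card (MultiIndex (n * j * m) n) : ℝ) ≤ (exp 1 * (1 + j * m)) ^ n := by
    convert card_multiIndex_le_pow_length (n * j * m) hn using 4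
    push_cast
    field_simp
  refine (pow_le_pow_iff_left₀ (by positivity) (by positivity) hn.ne').1 ?_
  calc ((‖analyticPoly (ε • c) x‖ ^ 2) ^ j) ^ n = ‖analyticPoly (ε • c) x‖ ^ (2 * (n * j)) := by
        rw [← pow_mul, ← pow_mul, mul_comm n j]
    _ ≤ Fintype.card (MultiIndex (n * j * m) n) *
          ∫ y, ‖analyticPoly (ε • c) y‖ ^ (2 * (n * j)) ∂torusHaar n :=
        norm_apply_pow_le_card_mul_integral (mem_polySpace_iff.2 ⟨_, rfl⟩) _ x
    _ ≤ (exp 1 * (1 + j * m)) ^ n *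
          (4 * exp 1 * (n * j : ℕ) * ∑ α, ‖c α‖ ^ 2) ^ (n * j) := by gcongr
    _ = (exp 1 * (1 + j * m) * (4 * exp 1 * (n * j) * ∑ α, ‖c α‖ ^ 2) ^ j) ^ n := by
        rw [mul_pow _ (_ ^ j), mul_comm n j, pow_mul, mul_comm j n, Nat.cast_mul]

theorem one_le_log_one_add_mul {m : ℕ} (hm : 0 < m) : 1 ≤ log (1 + 20 * m) := by
  have hm' : (1 : ℝ) ≤ m := Nat.one_le_cast.2 hm
  rw [le_log_iff_exp_le (by positivity)]
  linarith [exp_one_lt_three]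

theorem exp_one_mul_one_add_ceil_log_mul_le {m : ℕ} (hm : 0 < m) :
    exp 1 * (1 + ⌈log (1 + 20 * m)⌉₊ * m) ≤ (exp 1 ^ 3) ^ ⌈log (1 + 20 * m)⌉₊ := by
  have hm' : (1 : ℝ) ≤ m := Nat.one_le_cast.2 hm
  have hL := one_le_log_one_add_mul hm
  have hexp : exp (log (1 + 20 * m)) = 1 + 20 * m := exp_log (by positivity)
  have hlog : log (1 + 20 * m) ≤ 20 * m := by
    linarith [log_le_sub_one_of_pos (show (0 : ℝ) < 1 + 20 * m by positivity)]
  set L := log (1 + 20 * m)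
  have hceil : (⌈L⌉₊ : ℝ) ≤ 1 + 20 * m := by linarith [Nat.ceil_lt_add_one (zero_le_one.trans hL)]
  calc exp 1 * (1 + ⌈L⌉₊ * m) ≤ exp 1 * exp L ^ 2 := by
        rw [hexp]
        gcongr
        nlinarith
    _ = exp (1 + 2 * L) := by rw [exp_add, ← exp_nat_mul, Nat.cast_two]
    _ ≤ exp (3 * ⌈L⌉₊) := exp_le_exp.2 (by linarith [Nat.le_ceil L])
    _ = (exp 1 ^ 3) ^ ⌈L⌉₊ := by
        rw [← pow_mul, ← exp_nat_mul, mul_one, Nat.cast_mul, Nat.cast_ofNat]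

theorem exists_sign_norm_analyticPoly_le (hm : 0 < m) (hn : 0 < n) (c : MultiIndex m n → ℂ) :
    ∃ ε : MultiIndex m n → ℤˣ, ‖analyticPoly (ε • c)‖ ^ 2 ≤
      8 * exp 1 ^ 4 * n * log (1 + 20 * m) * ∑ α, ‖c α‖ ^ 2 := by
  set L := log (1 + 20 * m)
  have hL : 1 ≤ L := one_le_log_one_add_mul hm
  obtain ⟨ε, hε⟩ := exists_sign_norm_analyticPoly_apply_pow_le hn c ⌈L⌉₊
  refine ⟨ε, ?_⟩
  have hj : ⌈L⌉₊ ≠ 0 := (Nat.ceil_pos.2 (zero_lt_one.trans_le hL)).ne'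
  have hjL : (⌈L⌉₊ : ℝ) ≤ 2 * L := by linarith [Nat.ceil_lt_add_one (zero_le_one.trans hL)]
  rw [← Real.le_sqrt (norm_nonneg _) (by positivity),
    ContinuousMap.norm_le _ (Real.sqrt_nonneg _)]
  intro x
  rw [Real.le_sqrt (norm_nonneg _) (by positivity)]
  calc ‖analyticPoly (ε • c) x‖ ^ 2
      ≤ exp 1 ^ 3 * (4 * exp 1 * (n * ⌈L⌉₊) * ∑ α, ‖c α‖ ^ 2) := by
        refine (pow_le_pow_iff_left₀ (by positivity) (by positivity) hj).1 ((hε x).trans ?_)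
        rw [mul_pow (exp 1 ^ 3)]
        gcongr
        exact exp_one_mul_one_add_ceil_log_mul_le hm
    _ = 4 * exp 1 ^ 4 * n * (∑ α, ‖c α‖ ^ 2) * ⌈L⌉₊ := by ring
    _ ≤ 4 * exp 1 ^ 4 * n * (∑ α, ‖c α‖ ^ 2) * (2 * L) := by gcongr
    _ = 8 * exp 1 ^ 4 * n * L * ∑ α, ‖c α‖ ^ 2 := by ring

end KahaneSalemZygmund

section DiagonalOperators

open Real

theorem rpow_sum_rpow_le {ι : Type*} (s : Finset ι) {x : ι → ℝ} (hx : ∀ i ∈ s, 0 ≤ x i) {p q : ℝ}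
    (hp : 0 < p) (hpq : p ≤ q) :
    (∑ i ∈ s, x i ^ p) ^ (q / p) ≤ (s.card : ℝ) ^ (q / p - 1) * ∑ i ∈ s, x i ^ q := by
  refine (rpow_sum_le_const_mul_sum_rpow_of_nonneg s ((one_le_div hp).2 hpq) fun i hi =>
    rpow_nonneg (hx i hi) p).trans_eq ?_
  congr 1
  refine Finset.sum_congr rfl fun i hi => ?_
  rw [← rpow_mul (hx i hi), mul_div_cancel₀ _ hp.ne']

theorem norm_toLp_bhExponent_sq_le {m : ℕ} (hm : 0 < m) {Λ : Type*}
    [Fintype Λ] (v : Λ → ℂ) :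
    ‖WithLp.toLp (bhExponent m) v‖ ^ 2 ≤
      (Fintype.card Λ : ℝ) ^ (m : ℝ)⁻¹ * ∑ i, ‖v i‖ ^ 2 := by
  have hp : 0 < (2 * m / (m + 1) : ℝ) := by positivity
  have hp2 : (2 * m / (m + 1) : ℝ) ≤ 2 := by rw [div_le_iff₀ (by positivity)]; linarith
  have htoReal : (bhExponent m).toReal = 2 * m / (m + 1) := ENNReal.toReal_ofReal hp.le
  have hexp : 2 / (2 * m / (m + 1)) - 1 = (m : ℝ)⁻¹ := by field_simp; ring
  rw [PiLp.norm_eq_sum (htoReal ▸ hp), htoReal, ← rpow_mul_natCast (by positivity),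
    one_div_mul_eq_div, Nat.cast_ofNat]
  simpa only [hexp, Finset.card_univ, rpow_two] using
    rpow_sum_rpow_le Finset.univ (fun i _ => norm_nonneg (v i)) hp hp2

variable {m n : ℕ}

theorem card_multiIndex_rpow_inv_le (hm : 0 < m) (hn : 0 < n) :
    (Fintype.card (MultiIndex m n) : ℝ) ^ (m : ℝ)⁻¹ ≤ 2 * exp 1 * n := by
  have hm' : (1 : ℝ) ≤ m := Nat.one_le_cast.2 hm
  have hn' : (1 : ℝ) ≤ n := Nat.one_le_cast.2 hn
  calc (Fintype.card (MultiIndex m n) : ℝ) ^ (m : ℝ)⁻¹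
      ≤ ((exp 1 * (1 + n / m)) ^ m) ^ (m : ℝ)⁻¹ := by
        gcongr
        exact card_multiIndex_le_pow_degree hm n
    _ = exp 1 * (1 + n / m) := pow_rpow_inv_natCast (by positivity) hm.ne'
    _ ≤ exp 1 * (n + n) := by
        gcongr
        exact div_le_self (Nat.cast_nonneg n) hm'
    _ = 2 * exp 1 * n := by ring

theorem sum_norm_mul_le (ξ c : MultiIndex m n → ℂ) :
    ∑ α, ‖ξ α * c α‖ ≤ ‖multiplier ξ‖ * ‖analyticPoly c‖ := by
  let f : PolySpace m n := ⟨analyticPoly c, mem_polySpace_iff.2 ⟨c, rfl⟩⟩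
  have hcoeff (α : MultiIndex m n) : multiplier ξ f α = ξ α * c α :=
    congrArg (ξ α * ·) (mFourierCoeff_analyticPoly c α)
  have hnorm : ‖f‖ = ‖analyticPoly c‖ := rfl
  simpa only [PiLp.norm_eq_of_L1, hcoeff, hnorm] using (multiplier ξ).le_opNorm f

theorem norm_le_norm_multiplier (ξ : MultiIndex m n → ℂ) (α : MultiIndex m n) :
    ‖ξ α‖ ≤ ‖multiplier ξ‖ := by
  classical
  have hmonomial : analyticPoly (Pi.single α 1) = UnitAddTorus.mFourier α.toInt := by
    ext x
    simp [analyticPoly_apply, Pi.single_apply]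
  calc ‖ξ α‖ = ‖ξ α * (Pi.single α 1 : MultiIndex m n → ℂ) α‖ := by simp
    _ ≤ ∑ β, ‖ξ β * (Pi.single α 1 : MultiIndex m n → ℂ) β‖ :=
        Finset.single_le_sum (f := fun β => ‖ξ β * (Pi.single α 1 : MultiIndex m n → ℂ) β‖)
          (fun _ _ => norm_nonneg _) (Finset.mem_univ α)
    _ ≤ ‖multiplier ξ‖ := by
        simpa only [hmonomial, UnitAddTorus.mFourier_norm, mul_one] using
          sum_norm_mul_le ξ (Pi.single α 1)

theorem norm_toLp_one_mul_le (hm : 0 < m) (hn : 0 < n) (ξ : MultiIndex m n → ℂ)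
    (μ : EuclideanSpace ℂ (MultiIndex m n)) :
    ‖WithLp.toLp 1 fun α => ξ α * μ α‖ ≤
      2 * √2 * exp 1 ^ 2 * √n * ‖multiplier ξ‖ * (√(log (1 + 20 * m)) * ‖μ‖) := by
  obtain ⟨ε, hε⟩ := exists_sign_norm_analyticPoly_le hm hn μ
  have hL : 0 ≤ log (1 + 20 * m) := zero_le_one.trans (one_le_log_one_add_mul hm)
  have hpoly : ‖analyticPoly (ε • ⇑μ)‖ ≤
      2 * √2 * exp 1 ^ 2 * √n * √(log (1 + 20 * m)) * ‖μ‖ := by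
    refine le_of_sq_le_sq (hε.trans_eq ?_) (by positivity)
    simp only [mul_pow, sq_sqrt zero_le_two, sq_sqrt (Nat.cast_nonneg n), sq_sqrt hL,
      EuclideanSpace.norm_sq_eq]
    ring
  calc ‖WithLp.toLp 1 fun α => ξ α * μ α‖ = ∑ α, ‖ξ α * (ε • ⇑μ) α‖ := by
        simp only [PiLp.norm_eq_of_L1, Pi.smul_apply', norm_mul, norm_units_zsmul]
    _ ≤ ‖multiplier ξ‖ * (2 * √2 * exp 1 ^ 2 * √n * √(log (1 + 20 * m)) * ‖μ‖) := by
        refine (sum_norm_mul_le ξ _).trans ?_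
        gcongr
    _ = 2 * √2 * exp 1 ^ 2 * √n * ‖multiplier ξ‖ * (√(log (1 + 20 * m)) * ‖μ‖) := by ring

theorem norm_toLp_bhExponent_mul_le (hm : 0 < m) (hn : 0 < n)
    (ξ : MultiIndex m n → ℂ) (μ : EuclideanSpace ℂ (MultiIndex m n)) :
    ‖WithLp.toLp (bhExponent m) fun α => ξ α * μ α‖ ≤
      2 * √2 * exp 1 ^ 2 * √n * ‖multiplier ξ‖ * ‖μ‖ := by
  refine le_of_sq_le_sq ?_ (by positivity)
  have hexp : 2 * exp 1 ≤ 8 * exp 1 ^ 4 := by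
    gcongr
    · norm_num
    · exact le_self_pow₀ (one_le_exp zero_le_one) (by norm_num)
  calc ‖WithLp.toLp (bhExponent m) fun α => ξ α * μ α‖ ^ 2
      ≤ (Fintype.card (MultiIndex m n) : ℝ) ^ (m : ℝ)⁻¹ * ∑ α, ‖ξ α * μ α‖ ^ 2 :=
        norm_toLp_bhExponent_sq_le hm _
    _ ≤ 2 * exp 1 * n * ∑ α, (‖multiplier ξ‖ * ‖μ α‖) ^ 2 := by
        gcongr with α
        · exact card_multiIndex_rpow_inv_le hm hn
        · rw [norm_mul]
          gcongr
          exact norm_le_norm_multiplier ξ α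
    _ = 2 * exp 1 * (n * ‖multiplier ξ‖ ^ 2 * ‖μ‖ ^ 2) := by
        simp only [mul_pow, ← Finset.mul_sum, EuclideanSpace.norm_sq_eq]
        ring
    _ ≤ 8 * exp 1 ^ 4 * (n * ‖multiplier ξ‖ ^ 2 * ‖μ‖ ^ 2) := by gcongr
    _ = (2 * √2 * exp 1 ^ 2 * √n * ‖multiplier ξ‖ * ‖μ‖) ^ 2 := by
        simp only [mul_pow, sq_sqrt zero_le_two, sq_sqrt (Nat.cast_nonneg n)]
        ring

end DiagonalOperators

section Functors

theorem BanachIn.nrm_ι {V : Type} [AddCommGroup V] [Module ℂ V] [TopologicalSpace V]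
    (Z : BanachIn V) (x : Z.E) : Z.nrm (Z.ι x) = ‖x‖ₑ :=
  le_antisymm (iInf₂_le (f := fun (y : Z.E) (_ : Z.ι y = Z.ι x) => ‖y‖ₑ) x rfl)
    (le_iInf₂ fun _ hy => by rw [Z.injective hy])

theorem BanachIn.nrm_smul_le {V : Type} [AddCommGroup V] [Module ℂ V] [TopologicalSpace V]
    (Z : BanachIn V) {c : ℂ} (hc : c ≠ 0) (v : V) : Z.nrm (c • v) ≤ ‖c‖ₑ * Z.nrm v :=
  calc Z.nrm (c • v) ≤ ⨅ (x : Z.E) (_ : Z.ι x = v), ‖c‖ₑ * ‖x‖ₑ :=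
        le_iInf₂ fun x hx => by rw [← hx, ← map_smul, Z.nrm_ι, enorm_smul]
    _ = ‖c‖ₑ * Z.nrm v := by
        simp only [nrm, ENNReal.mul_iInf_of_ne (enorm_ne_zero.2 hc) enorm_ne_top]

theorem BanachIn.exists_ι_eq_of_nrm_le_one {V : Type} [AddCommGroup V] [Module ℂ V]
    [TopologicalSpace V] (Z : BanachIn V) {v : V} (hv : Z.nrm v ≤ 1) :
    ∃ x : Z.E, Z.ι x = v ∧ ‖x‖ ≤ 1 := by
  obtain ⟨x, hx, -⟩ : ∃ x, ∃ _ : Z.ι x = v, ‖x‖ₑ < ⊤ := by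
    simpa only [nrm, iInf_lt_iff] using hv.trans_lt ENNReal.one_lt_top
  rw [← hx, Z.nrm_ι, ← ofReal_norm, ENNReal.ofReal_le_one] at hv
  exact ⟨x, hx, hv⟩

/-- The operator `c ↦ c • y` from the couple `(ℂ, ℂ)` to the couple `Y`, for `y ∈ Y₀ ∩ Y₁`. The
vector `y` is given by its representatives `y₀` in `Y₀` and `y₁` in `Y₁`. -/
def orbitHom {Y : BanachCouple} (y₀ : Y.X₀.E) (y₁ : Y.X₁.E) (hy : Y.X₀.ι y₀ = Y.X₁.ι y₁) :
    CoupleHom scalarCouple Y where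
  T := (LinearMap.toSpanSingleton ℂ Y.sum
    ⟨Y.X₀.ι y₀, Submodule.mem_sup_left ⟨y₀, rfl⟩⟩).comp scalarCouple.sum.subtype
  T₀ := ContinuousLinearMap.toSpanSingleton ℂ y₀
  T₁ := ContinuousLinearMap.toSpanSingleton ℂ y₁
  restrict₀ (c : ℂ) _ hw :=
    (congrArg (fun c : ℂ => c • Y.X₀.ι y₀) hw).trans (map_smul Y.X₀.ι c y₀).symm
  restrict₁ (c : ℂ) _ hw :=
    (congrArg₂ (fun (c : ℂ) y => c • y) hw hy).trans (map_smul Y.X₁.ι c y₁).symm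

/-- The identity operator of a Banach couple. -/
def CoupleHom.id (X : BanachCouple) : CoupleHom X X where
  T := LinearMap.id
  T₀ := ContinuousLinearMap.id ℂ _
  T₁ := ContinuousLinearMap.id ℂ _
  restrict₀ _ _ h := h
  restrict₁ _ _ h := h

namespace InterpolationFunctor

variable {F : InterpolationFunctor}

theorem ι_mem_sum (F : InterpolationFunctor) {X : BanachCouple} (x : (F.obj X).E) :
    (F.obj X).ι x ∈ X.sum :=
  F.le_sum X ⟨x, rfl⟩

theorem map_id_apply (F : InterpolationFunctor) {X : BanachCouple} (x : (F.obj X).E) :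
    F.map (CoupleHom.id X) x = x :=
  (F.obj X).injective (F.map_spec (CoupleHom.id X) x ⟨_, F.ι_mem_sum x⟩ rfl).symm

theorem norm_map_le_fundamentalFunction (hF : F.IsExact) {X Y : BanachCouple} (T : CoupleHom X Y)
    {s t : ℝ} (h₀ : ‖T.T₀‖ ≤ s) (h₁ : ‖T.T₁‖ ≤ t) : ‖F.map T‖ ≤ F.fundamentalFunction s t := by
  refine le_csSup ⟨max s t, ?_⟩ ⟨X, Y, T, h₀, h₁, rfl⟩
  rintro _ ⟨X', Y', T', h₀', h₁', rfl⟩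
  exact (hF X' Y' T').trans (max_le_max h₀' h₁')

theorem fundamentalFunction_one_one (hF : F.IsExact) (hnorm : F.IsNormalized) :
    F.fundamentalFunction 1 1 = 1 := by
  refine le_antisymm (Real.sSup_le ?_ zero_le_one) ?_
  · rintro _ ⟨X, Y, T, h₀, h₁, rfl⟩
    exact (hF X Y T).trans (max_le h₀ h₁)
  obtain ⟨x, hx, -⟩ := (F.obj scalarCouple).exists_ι_eq_of_nrm_le_one hnorm
  have hx0 : x ≠ 0 := by
    rintro rfl
    exact zero_ne_one (α := ℂ) ((map_zero _).symm.trans hx)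
  have hid : 1 ≤ ‖F.map (CoupleHom.id scalarCouple)‖ := by
    refine le_of_mul_le_mul_right ?_ (norm_pos_iff.2 hx0)
    simpa only [map_id_apply, one_mul] using (F.map (CoupleHom.id scalarCouple)).le_opNorm x
  exact hid.trans (norm_map_le_fundamentalFunction hF _ ContinuousLinearMap.norm_id_le
    ContinuousLinearMap.norm_id_le)

theorem nrm_le_fundamentalFunction (hF : F.IsExact) (hnorm : F.IsNormalized) {Y : BanachCouple}
    {y₀ : Y.X₀.E} {y₁ : Y.X₁.E} (hy : Y.X₀.ι y₀ = Y.X₁.ι y₁) {s t : ℝ} (h₀ : ‖y₀‖ ≤ s)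
    (h₁ : ‖y₁‖ ≤ t) :
    (F.obj Y).nrm (Y.X₀.ι y₀) ≤ ENNReal.ofReal (F.fundamentalFunction s t) := by
  obtain ⟨x, hx, hx1⟩ := (F.obj scalarCouple).exists_ι_eq_of_nrm_le_one hnorm
  have horbit : (F.obj Y).ι (F.map (orbitHom y₀ y₁ hy) x) = Y.X₀.ι y₀ := by
    rw [← F.map_spec _ x ⟨_, F.ι_mem_sum x⟩ rfl]
    exact (congrArg (fun c : ℂ => c • Y.X₀.ι y₀) hx).trans (one_smul ℂ _)
  rw [← horbit, BanachIn.nrm_ι, ← ofReal_norm]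
  refine ENNReal.ofReal_le_ofReal (((F.map _).unit_le_opNorm x hx1).trans ?_)
  refine norm_map_le_fundamentalFunction hF _ ?_ ?_
  · exact (ContinuousLinearMap.norm_toSpanSingleton y₀).trans_le h₀
  · exact (ContinuousLinearMap.norm_toSpanSingleton y₁).trans_le h₁

theorem nrm_le_mul_fundamentalFunction (hF : F.IsExact) (hnorm : F.IsNormalized)
    {Y : BanachCouple} {y₀ : Y.X₀.E} {y₁ : Y.X₁.E} (hy : Y.X₀.ι y₀ = Y.X₁.ι y₁) {r s t : ℝ}
    (hr : 0 ≤ r) (h₀ : ‖y₀‖ ≤ r * s) (h₁ : ‖y₁‖ ≤ r * t) :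
    (F.obj Y).nrm (Y.X₀.ι y₀) ≤ ENNReal.ofReal (r * F.fundamentalFunction s t) := by
  rcases hr.eq_or_lt with rfl | hr
  · rw [zero_mul, norm_le_zero_iff] at h₀
    rw [h₀, map_zero, ← map_zero (F.obj Y).ι, BanachIn.nrm_ι, enorm_zero]
    exact zero_le
  have hr' : (r : ℂ) ≠ 0 := Complex.ofReal_ne_zero.2 hr.ne'
  have hscaled {E : Type} [NormedAddCommGroup E] [NormedSpace ℂ E] {y : E} {u : ℝ}
      (hyu : ‖y‖ ≤ r * u) : ‖(r : ℂ)⁻¹ • y‖ ≤ u := by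
    rwa [norm_smul, norm_inv, Complex.norm_of_nonneg hr.le, inv_mul_le_iff₀ hr]
  calc (F.obj Y).nrm (Y.X₀.ι y₀) = (F.obj Y).nrm ((r : ℂ) • Y.X₀.ι ((r : ℂ)⁻¹ • y₀)) := by
        rw [map_smul, smul_inv_smul₀ hr']
    _ ≤ ‖(r : ℂ)‖ₑ * (F.obj Y).nrm (Y.X₀.ι ((r : ℂ)⁻¹ • y₀)) := BanachIn.nrm_smul_le _ hr' _
    _ ≤ ENNReal.ofReal r * ENNReal.ofReal (F.fundamentalFunction s t) := by
        rw [← ofReal_norm, Complex.norm_of_nonneg hr.le]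
        gcongr
        exact nrm_le_fundamentalFunction hF hnorm (by rw [map_smul, map_smul, hy])
          (hscaled h₀) (hscaled h₁)
    _ = ENNReal.ofReal (r * F.fundamentalFunction s t) := (ENNReal.ofReal_mul hr.le).symm

end InterpolationFunctor

end Functors

end KislyakovInterpolation

end

theorem mainTheorem8 (F : KislyakovInterpolation.InterpolationFunctor) (hF : F.IsExact)
    (hnorm : F.IsNormalized) (m n : ℕ) (hm : 1 ≤ m) (hn : 1 ≤ n)
    (ξ : KislyakovInterpolation.MultiIndex m n → ℂ) :
    (⨆ (μ : EuclideanSpace ℂ (KislyakovInterpolation.MultiIndex m n)) (_ : ‖μ‖ ≤ 1),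
        (F.obj (KislyakovInterpolation.ellCouple m n hm)).nrm (fun α => ξ α * μ α)) ≤
      ENNReal.ofReal
        ((2 * √2 * Real.exp 1 ^ 2 * F.fundamentalFunction 1 1 *
            F.fundamentalFunction (√(Real.log (1 + 20 * m))) 1) *
          √n * ‖KislyakovInterpolation.multiplier ξ‖) := by
  refine iSup₂_le fun μ hμ => ?_
  set r := 2 * √2 * Real.exp 1 ^ 2 * √n * ‖KislyakovInterpolation.multiplier ξ‖ with hr
  have hr0 : 0 ≤ r := by positivity
  have h₀ : ‖WithLp.toLp 1 fun α => ξ α * μ α‖ ≤ r * √(Real.log (1 + 20 * m)) :=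
    (KislyakovInterpolation.norm_toLp_one_mul_le hm hn ξ μ).trans <|
      mul_le_mul_of_nonneg_left (mul_le_of_le_one_right (Real.sqrt_nonneg _) hμ) hr0
  have h₁ : ‖WithLp.toLp (KislyakovInterpolation.bhExponent m) fun α => ξ α * μ α‖ ≤ r * 1 :=
    (KislyakovInterpolation.norm_toLp_bhExponent_mul_le hm hn ξ μ).trans <|
      mul_le_mul_of_nonneg_left hμ hr0
  refine (KislyakovInterpolation.InterpolationFunctor.nrm_le_mul_fundamentalFunction hF hnorm
    (Y := KislyakovInterpolation.ellCouple m n hm) rfl hr0 h₀ h₁).trans_eq ?_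
  rw [KislyakovInterpolation.InterpolationFunctor.fundamentalFunction_one_one hF hnorm, hr]
  congr 1
  ring
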